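/- Let $(X,d)$ be a discrete metric space with bounded geometry, that is, for each $r>0$ the cardinalities of the closed balls $B(x,r)=\{y\in X: d(x,y)\le r\}$ are bounded uniformly in $x\in X$. For $r\ge 0$ let $E_r=\{(x,y)\in X\times X: d(x,y)\le r\}$, let $\overline{E_r}$ be its closure in the Stone–Čech compactification $\beta(X\times X)$, and let $\mathcal G(X)=\bigcup_{r\ge0}\overline{E_r}$ be the coarse groupoid of $X$. Its unit space is $\beta X$, its range map $\rho$ and source map $\sigma$ are the continuous extensions of the first and second factor maps $X\times X\to X$, and its groupoid operations extend those of the pair groupoid $X\times X$. Let $\ell:\mathcal G(X)\to[0,\infty)$ be the canonical length function, i.e. the continuous extension of $d$. For $\omega\in\beta X$ and $r>0$ put $B_\ell(\omega,r)=\{\eta\in\mathcal G(X): \sigma(\eta)=\omega,\ \ell(\omega\eta^{-1})\le r\}$. Then the following are equivalent: (i) $\mathcal G(X)$ has polynomial growth with respect to $\ell$: there are constants $C,n>0$ such that $|B_\ell(\omega,r)|\le C(1+r)^n$ for all $\omega\in\beta X$ and all $r>0$; (ii) $X$ has polynomial growth: there are constants $C,n>0$ such that $|B(x,r)|\le C(1+r)^n$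 for all $x\in X$ and all $r\ge0$. -/

import Mathlib

open Filter Topology Set CategoryTheory

open scoped NNReal

noncomputable section

/-! ### Groupoids with a length function

A groupoid is a Mathlib `Groupoid`; its unit space is the type of objects, an arrow `γ : x ⟶ y` has
source `x` and range `y`, and the groupoid product `γ * η` (first `η`, then `γ`) is `η ≫ γ`. -/

/-- A length function on a groupoid: a map to `[0, ∞)` that vanishes on units, is invariant under
inversion and is subadditive on composable pairs. -/
structure GroupoidLength (G : Type*) [Groupoid G] where
  len : ∀ {x y : G}, (x ⟶ y) → ℝ≥0
  len_id : ∀ x : G, len (𝟙 x) = 0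
  len_inv : ∀ {x y : G} (γ : x ⟶ y), len (Groupoid.inv γ) = len γ
  len_comp : ∀ {x y z : G} (η : x ⟶ y) (γ : y ⟶ z), len (η ≫ γ) ≤ len γ + len η

namespace GroupoidLength

variable {G : Type*} [Groupoid G] (l : GroupoidLength G)

/-- The source fibre at `x`: all arrows with source `x`. -/
abbrev SourceFibre {G : Type*} [Groupoid G] (x : G) := Σ z : G, (x ⟶ z)

/-- The closed ball `{η ∈ G_x : l (γ η⁻¹) ≤ r}` around an arrow `γ` with source `x`. -/
def ball {x y : G} (γ : x ⟶ y) (r : ℝ) : Set (SourceFibre x) :=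
  {η | (l.len (Groupoid.inv η.2 ≫ γ) : ℝ) ≤ r}

/-- Polynomial growth of a groupoid with respect to a length function: the cardinality of the
balls around the units is bounded by `C * (1 + r) ^ n`. -/
def PolynomialGrowth : Prop :=
  ∃ C n : ℝ, 0 < C ∧ 0 < n ∧ ∀ (x : G) (r : ℝ), 0 < r →
    (l.ball (𝟙 x) r).Finite ∧ ((l.ball (𝟙 x) r).ncard : ℝ) ≤ C * (1 + r) ^ n

end GroupoidLength

/-! ### Metric spaces -/

/-- Bounded geometry: for each `r > 0` the balls of radius `r` have uniformly bounded cardinality. -/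
class BoundedGeometry (X : Type*) [MetricSpace X] : Prop where
  exists_bound : ∀ r : ℝ, 0 < r → ∃ N : ℕ, ∀ x : X, (Metric.closedBall x r).encard ≤ N

/-- Polynomial growth of a metric space. -/
def MetricPolynomialGrowth (X : Type*) [MetricSpace X] : Prop :=
  ∃ C n : ℝ, 0 < C ∧ 0 < n ∧ ∀ (x : X) (r : ℝ), 0 ≤ r →
    (Metric.closedBall x r).Finite ∧ ((Metric.closedBall x r).ncard : ℝ) ≤ C * (1 + r) ^ n

/-! ### The coarse groupoid

For a discrete space `Y`, `Ultrafilter Y` with its topology is the Stone-Cech compactification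
of `Y`, the embedding of `Y` being `pure`, and `Ultrafilter.map f` is the continuous extension of a
map `f` of discrete spaces. -/

namespace CoarseGroupoid

variable {X : Type*}

variable (X) in
/-- The tube of radius `r`. -/
def tube [MetricSpace X] (r : ℝ) : Set (X × X) := {p | dist p.1 p.2 ≤ r}

variable (X) in
/-- The coarse groupoid as a space: the union of the closures of the tubes in the Stone-Cech
compactification of `X × X`. -/
def arrows [MetricSpace X] : Set (Ultrafilter (X × X)) :=
  ⋃ r ∈ Ici (0 : ℝ), closure ((pure : X × X → Ultrafilter (X × X)) '' tube X r)

/-- The range map, extending the first factor map. -/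
def range (γ : Ultrafilter (X × X)) : Ultrafilter X := γ.map Prod.fst

/-- The source map, extending the second factor map. -/
def source (γ : Ultrafilter (X × X)) : Ultrafilter X := γ.map Prod.snd

/-- The unit at `ω`, extending `x ↦ (x, x)`. -/
def unit (ω : Ultrafilter X) : Ultrafilter (X × X) := ω.map fun x => (x, x)

/-- The inverse, extending `(x, y) ↦ (y, x)`. -/
def inverse (γ : Ultrafilter (X × X)) : Ultrafilter (X × X) := γ.map Prod.swap

/-- The filter on composable pairs `((x, y), (y, z))`, coded as triples `(x, y, z)`, of those
pairs that tend to `(γ, η)`. -/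
def composable (γ η : Ultrafilter (X × X)) : Filter (X × X × X) :=
  comap (fun t => (t.1, t.2.1)) (γ : Filter (X × X)) ⊓ comap (fun t => t.2) (η : Filter (X × X))

theorem composable_neBot {γ η : Ultrafilter (X × X)} (h : source γ = range η) :
    (composable γ η).NeBot := by
  rw [composable, Filter.inf_neBot_iff]
  intro s hs t ht
  obtain ⟨A, hA, hAs⟩ := hs
  obtain ⟨B, hB, hBt⟩ := ht
  have h1 : Prod.snd '' A ∈ source γ :=
    Filter.mem_map.2 (mem_of_superset hA (subset_preimage_image _ _))
  have h2 : Prod.fst '' B ∈ source γ := by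
    rw [h]
    exact Filter.mem_map.2 (mem_of_superset hB (subset_preimage_image _ _))
  obtain ⟨y, ⟨⟨x, y1⟩, hp, rfl⟩, ⟨⟨y2, z⟩, hq, hy⟩⟩ :=
    Ultrafilter.nonempty_of_mem (inter_mem h1 h2)
  simp only at hy
  subst hy
  exact ⟨(x, y2, z), hAs hp, hBt hq⟩

/-- The limit of composable pairs along which the product is taken. -/
def composableLim (γ η : Ultrafilter (X × X)) (h : source γ = range η) : Ultrafilter (X × X × X) :=
  @Ultrafilter.of _ (composable γ η) (composable_neBot h)

/-- The product `γ η`, extending `(x, y) (y, z) = (x, z)`: a limit of the products of composable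
pairs tending to `(γ, η)`. For `γ`, `η` in the coarse groupoid of a space of bounded geometry
it is the only such limit, by `eq_of_range_eq_of_source_eq`. -/
def product (γ η : Ultrafilter (X × X)) (h : source γ = range η) : Ultrafilter (X × X) :=
  (composableLim γ η h).map fun t => (t.1, t.2.2)

/-- The canonical length function, extending the metric continuously. -/
def length [MetricSpace X] (γ : Ultrafilter (X × X)) : ℝ≥0 :=
  Ultrafilter.extend (fun p : X × X => nndist p.1 p.2) γ

theorem closure_pure_image {Y : Type*} (S : Set Y) :
    closure ((pure : Y → Ultrafilter Y) '' S) = {γ | S ∈ γ} := by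
  apply subset_antisymm
  · refine closure_minimal ?_ (ultrafilter_isClosed_basic S)
    rintro _ ⟨y, hy, rfl⟩
    exact Ultrafilter.mem_pure.2 hy
  · intro γ hγ
    rw [ultrafilterBasis_is_basis.mem_closure_iff]
    rintro _ ⟨T, rfl⟩ hT
    obtain ⟨y, hyT, hyS⟩ := Ultrafilter.nonempty_of_mem (inter_mem (show T ∈ γ from hT) hγ)
    exact ⟨pure y, Ultrafilter.mem_pure.2 hyT, y, hyS, rfl⟩

theorem composableLim_le (γ η : Ultrafilter (X × X)) (h : source γ = range η) :
    (composableLim γ η h : Filter (X × X × X)) ≤ composable γ η :=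
  @Ultrafilter.of_le _ (composable γ η) (composable_neBot h)

theorem map_left_composableLim (γ η : Ultrafilter (X × X)) (h : source γ = range η) :
    (composableLim γ η h).map (fun t => (t.1, t.2.1)) = γ :=
  Ultrafilter.coe_le_coe.1
    ((map_mono ((composableLim_le γ η h).trans inf_le_left)).trans map_comap_le)

theorem map_right_composableLim (γ η : Ultrafilter (X × X)) (h : source γ = range η) :
    (composableLim γ η h).map (fun t => t.2) = η :=
  Ultrafilter.coe_le_coe.1
    ((map_mono ((composableLim_le γ η h).trans inf_le_right)).trans map_comap_le)

theorem range_product (γ η : Ultrafilter (X × X)) (h : source γ = range η) :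
    range (product γ η h) = range γ := by
  conv_rhs => rw [← map_left_composableLim γ η h]
  simp only [range, product, Ultrafilter.map_map]
  rfl

theorem source_product (γ η : Ultrafilter (X × X)) (h : source γ = range η) :
    source (product γ η h) = source η := by
  conv_rhs => rw [← map_right_composableLim γ η h]
  simp only [source, product, Ultrafilter.map_map]
  rfl

theorem source_inverse (γ : Ultrafilter (X × X)) : source (inverse γ) = range γ := rfl

theorem range_inverse (γ : Ultrafilter (X × X)) : range (inverse γ) = source γ := rfl

theorem source_unit (ω : Ultrafilter X) : source (unit ω) = ω := rfl

theorem range_unit (ω : Ultrafilter X) : range (unit ω) = ω := rfl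

variable [MetricSpace X]

theorem mem_arrows {γ : Ultrafilter (X × X)} :
    γ ∈ arrows X ↔ ∃ r : ℝ, 0 ≤ r ∧ tube X r ∈ γ := by
  simp [arrows, closure_pure_image]

theorem pure_mem_arrows (p : X × X) : (pure p : Ultrafilter (X × X)) ∈ arrows X :=
  mem_arrows.2 ⟨dist p.1 p.2, dist_nonneg, Ultrafilter.mem_pure.2 (le_refl (dist p.1 p.2))⟩

theorem unit_mem (ω : Ultrafilter X) : unit ω ∈ arrows X := by
  refine mem_arrows.2 ⟨0, le_rfl, Filter.mem_map.2 (univ_mem' fun x => ?_)⟩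
  simp [tube]

theorem inverse_mem {γ : Ultrafilter (X × X)} (h : γ ∈ arrows X) : inverse γ ∈ arrows X := by
  obtain ⟨r, hr, hγ⟩ := mem_arrows.1 h
  refine mem_arrows.2 ⟨r, hr, Filter.mem_map.2 (mem_of_superset hγ fun p hp => ?_)⟩
  simpa [tube, dist_comm] using hp

theorem product_mem {γ η : Ultrafilter (X × X)} (h : source γ = range η) (hγ : γ ∈ arrows X)
    (hη : η ∈ arrows X) : product γ η h ∈ arrows X := by
  obtain ⟨r, hr, h1⟩ := mem_arrows.1 hγ
  obtain ⟨s, hs, h2⟩ := mem_arrows.1 hη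
  rw [← map_left_composableLim γ η h] at h1
  rw [← map_right_composableLim γ η h] at h2
  refine mem_arrows.2 ⟨r + s, add_nonneg hr hs, Filter.mem_map.2 ?_⟩
  refine mem_of_superset (inter_mem (Filter.mem_map.1 h1) (Filter.mem_map.1 h2)) ?_
  rintro ⟨x, y, z⟩ ⟨hxy, hyz⟩
  exact (dist_triangle x y z).trans (add_le_add hxy hyz)

/-- On the coarse groupoid, `length γ` is the limit of the metric along `γ`. -/
theorem tendsto_length {γ : Ultrafilter (X × X)} (h : γ ∈ arrows X) :
    Tendsto (fun p : X × X => nndist p.1 p.2) γ (𝓝 (length γ)) := by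
  obtain ⟨r, hr, hγ⟩ := mem_arrows.1 h
  obtain ⟨c, -, hc⟩ := (isCompact_Icc (a := (0 : ℝ≥0)) (b := r.toNNReal)).ultrafilter_le_nhds
    (γ.map fun p : X × X => nndist p.1 p.2) (by
      refine le_principal_iff.2 (Filter.mem_map.2 (mem_of_superset hγ fun p hp => ?_))
      exact ⟨zero_le, NNReal.le_toNNReal_of_coe_le hp⟩)
  let _ : TopologicalSpace (X × X) := ⊥
  have : length γ = c := isDenseInducing_pure.extend_eq_of_tendsto
    (le_trans (map_mono (ultrafilter_comap_pure_nhds _)) hc)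
  rw [this]
  exact hc

theorem length_pure (p : X × X) : length (pure p) = nndist p.1 p.2 :=
  ultrafilter_extend_pure _ p

theorem continuousOn_length : ContinuousOn length (arrows X) := by
  intro γ h
  obtain ⟨r, hr, hγ⟩ := mem_arrows.1 h
  let _ : TopologicalSpace (X × X) := ⊥
  refine ContinuousAt.continuousWithinAt (isDenseInducing_pure.continuousAt_extend ?_)
  filter_upwards [(ultrafilter_isOpen_basic (tube X r)).mem_nhds hγ] with η hη
  exact ⟨length η, (tendsto_length (mem_arrows.2 ⟨r, hr, hη⟩)).mono_left
    (ultrafilter_comap_pure_nhds _)⟩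

theorem length_unit (ω : Ultrafilter X) : length (unit ω) = 0 := by
  refine tendsto_nhds_unique (tendsto_length (unit_mem ω)) ?_
  refine tendsto_const_nhds.congr' (Filter.mem_map.2 (univ_mem' fun x => ?_))
  simp

theorem length_inverse {γ : Ultrafilter (X × X)} (h : γ ∈ arrows X) :
    length (inverse γ) = length γ := by
  refine tendsto_nhds_unique (f := fun p : X × X => nndist p.2 p.1) (l := γ)
    (tendsto_map'_iff.1 (tendsto_length (inverse_mem h))) ?_
  simpa only [nndist_comm] using tendsto_length h

theorem length_product_le {γ η : Ultrafilter (X × X)} (h : source γ = range η)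
    (hγ : γ ∈ arrows X) (hη : η ∈ arrows X) :
    length (product γ η h) ≤ length γ + length η := by
  have h1 := tendsto_length hγ
  have h2 := tendsto_length hη
  have e1 := congrArg (fun u : Ultrafilter (X × X) => (u : Filter (X × X)))
    (map_left_composableLim γ η h)
  have e2 := congrArg (fun u : Ultrafilter (X × X) => (u : Filter (X × X)))
    (map_right_composableLim γ η h)
  simp only [Ultrafilter.coe_map] at e1 e2
  rw [← e1, tendsto_map'_iff] at h1
  rw [← e2, tendsto_map'_iff] at h2
  have h3 : Tendsto (fun t : X × X × X => nndist t.1 t.2.2) (composableLim γ η h)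
      (𝓝 (length (product γ η h))) :=
    tendsto_map'_iff.1 (tendsto_length (product_mem h hγ hη))
  exact le_of_tendsto_of_tendsto' h3 (h1.add h2) fun t => nndist_triangle t.1 t.2.1 t.2.2

/-- In a space of bounded geometry, finitely many colours suffice to separate the points of each
ball of a given radius. -/
theorem exists_colouring [BoundedGeometry X] (r : ℝ) (hr : 0 < r) :
    ∃ (N : ℕ) (c : X → ℕ), (∀ x, c x < N) ∧ ∀ x y, dist x y ≤ r → c x = c y → x = y := by
  obtain ⟨N, hN⟩ := BoundedGeometry.exists_bound (X := X) r hr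
  have hfin : ∀ x : X, (Metric.closedBall x r).Finite := fun x =>
    Set.finite_of_encard_le_coe (hN x)
  have key : ∀ (x : X) (f : ∀ y : X, WellOrderingRel y x → ℕ),
      ∃ n, n < N + 1 ∧ ∀ y (h : WellOrderingRel y x), dist y x ≤ r → f y h ≠ n := by
    intro x f
    classical
    let g : X → ℕ := fun y => if h : WellOrderingRel y x then f y h else 0
    have hcard : ((hfin x).toFinset.image g).card < (Finset.range (N + 1)).card := by
      rw [Finset.card_range]
      refine Nat.lt_succ_of_le (Finset.card_image_le.trans ?_)
      have := hN x
      rw [(hfin x).encard_eq_coe_toFinset_card] at this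
      exact_mod_cast this
    obtain ⟨n, hn, hn'⟩ := Finset.exists_mem_notMem_of_card_lt_card hcard
    refine ⟨n, Finset.mem_range.1 hn, fun y h hd hf => hn' ?_⟩
    refine Finset.mem_image.2 ⟨y, (hfin x).mem_toFinset.2 hd, ?_⟩
    simp only [g, dif_pos h, hf]
  choose F hF using key
  have wf : WellFounded (WellOrderingRel : X → X → Prop) := IsWellFounded.wf
  have hc : ∀ x, wf.fix F x = F x (fun y _ => wf.fix F y) := fun x => wf.fix_eq F x
  have main : ∀ x y, WellOrderingRel y x → dist y x ≤ r → wf.fix F y ≠ wf.fix F x := by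
    intro x y h hd
    rw [hc x]
    exact (hF x (fun z _ => wf.fix F z)).2 y h hd
  refine ⟨N + 1, wf.fix F, fun x => ?_, fun x y hd he => ?_⟩
  · rw [hc x]
    exact (hF x _).1
  · rcases trichotomous_of WellOrderingRel x y with h | h | h
    · exact absurd he (main y x h hd)
    · exact h
    · exact absurd he.symm (main x y h (by rwa [dist_comm]))

/-- The coarse groupoid is principal: an arrow is determined by its range and source. -/
theorem eq_of_range_eq_of_source_eq [BoundedGeometry X] {γ η : Ultrafilter (X × X)}
    (hγ : γ ∈ arrows X) (hη : η ∈ arrows X) (hr : range γ = range η)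
    (hs : source γ = source η) : γ = η := by
  obtain ⟨r1, h1, hγ1⟩ := mem_arrows.1 hγ
  obtain ⟨r2, h2, hη1⟩ := mem_arrows.1 hη
  obtain ⟨N, c, hcN, hc⟩ := exists_colouring (X := X) (r1 + r2 + 1) (by positivity)
  obtain ⟨i, -, hi⟩ : ∃ i ∈ Iio N, {x | c x = i} ∈ range γ := by
    refine (Ultrafilter.finite_biUnion_mem_iff (finite_Iio N)).1 (univ_mem' fun x => ?_)
    simp [hcN x]
  have hi' := hi
  rw [hr] at hi'
  refine Ultrafilter.coe_le_coe.1 fun S hS => ?_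
  have hT : Prod.snd '' (S ∩ (tube X r2 ∩ Prod.fst ⁻¹' {x | c x = i})) ∈ source γ := by
    rw [hs]
    exact Filter.mem_map.2 (mem_of_superset (inter_mem hS (inter_mem hη1 hi'))
      (subset_preimage_image _ _))
  refine mem_of_superset (inter_mem (Filter.mem_map.1 hT) (inter_mem hγ1 hi)) ?_
  rintro ⟨x, y⟩ ⟨⟨⟨x', y'⟩, ⟨hS', hd', hi2⟩, hy⟩, hd, hi1⟩
  simp only [tube, mem_preimage, Set.mem_ofPred_eq] at hy hd hd' hi1 hi2
  subst hy
  have : x = x' := by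
    refine hc x x' ?_ (hi1.trans hi2.symm)
    have := dist_triangle_right x x' y'
    linarith
  rwa [this]

variable (X) in
/-- The unit space of the coarse groupoid: the Stone-Cech compactification of `X`. -/
def Units : Type _ := Ultrafilter X

/-- The arrows of the coarse groupoid with given source and range. -/
def Hom (ω ω' : Units X) : Type _ :=
  {γ : Ultrafilter (X × X) // γ ∈ arrows X ∧ source γ = ω ∧ range γ = ω'}

instance [BoundedGeometry X] (ω ω' : Units X) : Subsingleton (Hom ω ω') :=
  ⟨fun a b => Subtype.ext (eq_of_range_eq_of_source_eq a.2.1 b.2.1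
    (a.2.2.2.trans b.2.2.2.symm) (a.2.2.1.trans b.2.2.1.symm))⟩

/-- The groupoid structure on the coarse groupoid, extending that of the pair groupoid `X × X`. -/
instance [BoundedGeometry X] : Groupoid (Units X) where
  Hom ω ω' := Hom ω ω'
  id ω := ⟨unit ω, unit_mem _, source_unit ω, range_unit ω⟩
  comp η γ := ⟨product γ.1 η.1 (γ.2.2.1.trans η.2.2.2.symm), product_mem _ γ.2.1 η.2.1,
    (source_product _ _ _).trans η.2.2.1, (range_product _ _ _).trans γ.2.2.2⟩
  inv γ := ⟨inverse γ.1, inverse_mem γ.2.1, (source_inverse γ.1).trans γ.2.2.2,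
    (range_inverse γ.1).trans γ.2.2.1⟩
  id_comp _ := Subsingleton.elim (α := Hom _ _) _ _
  comp_id _ := Subsingleton.elim (α := Hom _ _) _ _
  assoc _ _ _ := Subsingleton.elim (α := Hom _ _) _ _
  inv_comp _ := Subsingleton.elim (α := Hom _ _) _ _
  comp_inv _ := Subsingleton.elim (α := Hom _ _) _ _

variable (X) in
/-- The canonical length function on the coarse groupoid. -/
def lengthFunction [BoundedGeometry X] : GroupoidLength (Units X) where
  len γ := length γ.1
  len_id ω := length_unit ω
  len_inv γ := length_inverse γ.2.1
  len_comp η γ := length_product_le _ γ.2.1 η.2.1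

end CoarseGroupoid

end

namespace CoarseGroupoid

variable {X : Type*}

/-! Balls of `X` and balls around units of the groupoid bound each other, up to enlarging the radius
by 1. From `X` to the groupoid: finitely many distinct ultrafilters on `X × X` have pairwise
disjoint members. If all have source `ω` and contain the tube of radius `R`, the second projections
of these members, cut down to the tube, lie in `ω` and so share a point `y`. Lifting `y` to each
member gives distinct points of the ball of radius `R` around `y`
(`exists_card_le_encard_closedBall`). Hence a uniform bound on balls of `X` passes to the source
fibres (`encard_ball_id_le`). From the groupoid to `X`: the pair groupoid sits inside via principal
ultrafilters, with length equal to distance (`image_pairArrow_subset`). -/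

/-- Distinct ultrafilters with the same source that contain the tube of radius `R` yield distinct
points in some ball of radius `R`. -/
theorem exists_card_le_encard_closedBall [MetricSpace X] (ω : Ultrafilter X) (R : ℝ)
    (F : Finset (Ultrafilter (X × X))) (hsource : ∀ γ ∈ F, source γ = ω)
    (htube : ∀ γ ∈ F, tube X R ∈ γ) :
    ∃ y : X, (F.card : ℕ∞) ≤ (Metric.closedBall y R).encard := by
  obtain ⟨S, hS, hdisj⟩ := Set.PairwiseDisjoint.exists_mem_filter
    (l := fun γ : Ultrafilter (X × X) => (γ : Filter (X × X))) (t := (F : Set _))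
    (fun γ _ η _ h => Ultrafilter.disjoint_iff_not_le.2 fun hle => h (Ultrafilter.coe_le_coe.1 hle))
    F.finite_toSet
  have hmem : (⋂ γ ∈ F, Prod.snd '' (S γ ∩ tube X R)) ∈ ω := by
    refine (Filter.biInter_finset_mem F).2 fun γ hγ => ?_
    rw [← hsource γ hγ]
    exact Filter.mem_map.2 (mem_of_superset (inter_mem (hS γ) (htube γ hγ))
      (subset_preimage_image _ _))
  obtain ⟨y, hy⟩ := Ultrafilter.nonempty_of_mem hmem
  have hpoint : ∀ γ ∈ F, ∃ x : X, (x, y) ∈ S γ ∧ dist x y ≤ R := by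
    intro γ hγ
    obtain ⟨⟨x, y'⟩, ⟨h1, h2⟩, rfl⟩ := mem_iInter₂.1 hy γ hγ
    exact ⟨x, h1, h2⟩
  have : Nonempty X := ⟨y⟩
  choose! x hxS hxR using hpoint
  refine ⟨y, ?_⟩
  -- A repeated value would put the same pair `(x γ, y)` in two disjoint members.
  have hinj : InjOn x (F : Set (Ultrafilter (X × X))) := by
    intro γ hγ η hη h
    by_contra hne
    refine Set.disjoint_left.1 (hdisj hγ hη hne) (hxS γ hγ) ?_
    rw [h]
    exact hxS η hη
  rw [← Set.encard_coe_eq_coe_finsetCard, ← hinj.encard_image]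
  refine Set.encard_le_encard ?_
  rintro _ ⟨γ, hγ, rfl⟩
  exact hxR γ hγ

variable [MetricSpace X]

/-- Distances converge to the length along `γ`. The inequality must be strict, since a limit equal
to `R` may be approached from above. -/
theorem tube_mem_of_length_lt {γ : Ultrafilter (X × X)} (h : γ ∈ arrows X) {R : ℝ}
    (hR : (length γ : ℝ) < R) : tube X R ∈ γ := by
  have ht := (NNReal.tendsto_coe.2 (tendsto_length h)).eventually (gt_mem_nhds hR)
  exact mem_of_superset ht fun p hp => show dist p.1 p.2 ≤ R from le_of_lt hp

variable [BoundedGeometry X]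

theorem mem_ball_id {ω : Units X} {r : ℝ} {η : GroupoidLength.SourceFibre ω} :
    η ∈ (lengthFunction X).ball (𝟙 ω) r ↔ (length η.2.1 : ℝ) ≤ r := by
  change ((lengthFunction X).len (Groupoid.inv η.2 ≫ 𝟙 ω) : ℝ) ≤ r ↔ _
  rw [Category.comp_id, (lengthFunction X).len_inv]
  rfl

/-- The range is determined by the ultrafilter, so counting arrows in a source fibre amounts to
counting ultrafilters. -/
theorem sourceFibre_val_injective (ω : Units X) :
    Function.Injective
      (fun η : GroupoidLength.SourceFibre ω => (η.2.1 : Ultrafilter (X × X))) := by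
  rintro ⟨z, γ, hγ, hs, rfl⟩ ⟨z', γ', hγ', hs', rfl⟩ h
  change γ = γ' at h
  subst h
  rfl

theorem encard_ball_id_le {N : ℕ} {r R : ℝ} (hrR : r < R)
    (hN : ∀ y : X, (Metric.closedBall y R).encard ≤ N) (ω : Units X) :
    ((lengthFunction X).ball (𝟙 ω) r).encard ≤ N := by
  rw [← (sourceFibre_val_injective ω).encard_image]
  by_contra! hlt
  -- The ball is not yet known to be finite, so the counting lemma is applied to a subset of exactly
  -- `N + 1` elements.
  obtain ⟨T, hT, hcard⟩ := Set.exists_subset_encard_eq (Order.add_one_le_of_lt hlt)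
  have hfin : T.Finite := Set.finite_of_encard_eq_coe (k := N + 1) (by exact_mod_cast hcard)
  obtain ⟨y, hy⟩ := exists_card_le_encard_closedBall ω R hfin.toFinset
    (fun γ hγ => by
      obtain ⟨η, -, rfl⟩ := hT (hfin.mem_toFinset.1 hγ)
      exact η.2.2.2.1)
    (fun γ hγ => by
      obtain ⟨η, hη, rfl⟩ := hT (hfin.mem_toFinset.1 hγ)
      exact tube_mem_of_length_lt η.2.2.1 ((mem_ball_id.1 hη).trans_lt hrR))
  rw [← hfin.encard_eq_coe_toFinset_card, hcard] at hy
  have := hy.trans (hN y)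
  norm_cast at this
  omega

/-- The arrow `(y, x)` of the pair groupoid, in the source fibre at `x`. -/
def pairArrow (x y : X) : GroupoidLength.SourceFibre (G := Units X) (pure x : Ultrafilter X) :=
  ⟨(pure y : Ultrafilter X), ⟨pure (y, x), pure_mem_arrows _, Ultrafilter.map_pure _ _,
    Ultrafilter.map_pure _ _⟩⟩

theorem pairArrow_injective (x : X) : Function.Injective (pairArrow x) := by
  intro y z h
  have h' : (pure y : Ultrafilter X) = pure z := congrArg Sigma.fst h
  exact Ultrafilter.pure_injective h'

theorem image_pairArrow_subset (x : X) (r : ℝ) :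
    pairArrow x '' Metric.closedBall x r ⊆
      (lengthFunction X).ball (CategoryStruct.id (obj := Units X) (pure x : Ultrafilter X)) r := by
  rintro _ ⟨y, hy, rfl⟩
  refine mem_ball_id.2 ?_
  change (length (pure (y, x)) : ℝ) ≤ r
  rw [length_pure]
  exact hy

end CoarseGroupoid

/-- Absorbs the radius shift into the constant, as `2 + r ≤ 2 * (1 + r)`. -/
theorem mul_two_add_rpow_le {C n r : ℝ} (hC : 0 < C) (hn : 0 < n) (hr : 0 ≤ r) :
    C * (1 + (r + 1)) ^ n ≤ C * 2 ^ n * (1 + r) ^ n := by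
  rw [mul_assoc, ← Real.mul_rpow (by norm_num) (by linarith)]
  gcongr
  linarith

theorem lemma3p6 (X : Type*) [MetricSpace X] [DiscreteTopology X] [BoundedGeometry X] :
    (CoarseGroupoid.lengthFunction X).PolynomialGrowth ↔ MetricPolynomialGrowth X := by
  constructor
  · rintro ⟨C, n, hC, hn, h⟩
    refine ⟨C * 2 ^ n, n, by positivity, hn, fun x r hr => ?_⟩
    -- The groupoid bound needs a positive radius, while `r = 0` is allowed here; hence `r + 1`.
    obtain ⟨hfin, hcard⟩ := h (pure x : Ultrafilter X) (r + 1) (by linarith)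
    have hsub : CoarseGroupoid.pairArrow x '' Metric.closedBall x r ⊆ _ :=
      (image_mono (Metric.closedBall_subset_closedBall (by linarith))).trans
        (CoarseGroupoid.image_pairArrow_subset x (r + 1))
    refine ⟨(hfin.subset hsub).of_finite_image (CoarseGroupoid.pairArrow_injective x).injOn, ?_⟩
    rw [← Set.ncard_image_of_injective _ (CoarseGroupoid.pairArrow_injective x)]
    exact ((Nat.cast_le.2 (Set.ncard_le_ncard hsub hfin)).trans hcard).trans
      (mul_two_add_rpow_le hC hn hr)
  · rintro ⟨C, n, hC, hn, h⟩
    refine ⟨C * 2 ^ n, n, by positivity, hn, fun ω r hr => ?_⟩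
    have hpos : 0 ≤ C * (1 + (r + 1)) ^ n := by positivity
    -- Here `r + 1` supplies the strictly larger tube radius, and the floor turns the real bound
    -- into a natural one.
    have hball := CoarseGroupoid.encard_ball_id_le (N := ⌊C * (1 + (r + 1)) ^ n⌋₊)
      (lt_add_one r) (fun y : X => by
        obtain ⟨hfin, hcard⟩ := h y (r + 1) (by linarith)
        rw [← hfin.cast_ncard_eq]
        exact Nat.cast_le.2 (Nat.le_floor hcard)) ω
    have hfin := Set.finite_of_encard_le_coe hball
    refine ⟨hfin, ?_⟩
    rw [← hfin.cast_ncard_eq, Nat.cast_le] at hball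
    exact ((Nat.le_floor_iff hpos).1 hball).trans (mul_two_add_rpow_le hC hn hr.le)
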